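/- Let $d\in\{2,3\}$ and let $D\subset\mathbb{R}^d$ be a bounded open set (for instance a bounded Lipschitz domain). Let $k_0,\delta,\Omega\in\mathbb{R}$ and $\beta_{11},\beta_{12},\beta_{22}\ge 0$, and let $V_1,V_2\in L^\infty(D,\mathbb{R}_{\ge0})$ satisfy $$V_j(x)-\tfrac12\big(|\delta|+|\Omega|+2k_0^2\big)\ge 0\quad\text{for a.e. }x\in D,\ j=1,2 .$$ Write $\mathbf H^1_0=H^1_0(D,\mathbb{C}^2)$ for the closure of $C_c^\infty(D,\mathbb{C}^2)$ in the $H^1$-norm $\|v\|_{H^1}^2=\|v\|_{L^2}^2+\|\nabla v\|_{L^2}^2$, regarded as a real Hilbert space, $\mathbf H^{-1}$ for its (real) dual, and $(v,w)_{L^2}=\Re\int_D (v_1\bar w_1+v_2\bar w_2)\,dx$. For $u\in\mathbf H^1_0\setminus\{0\}$ and $v,w\in\mathbf H^1_0$ let $$\begin{aligned}\langle A(u)v,w\rangle={}&\Re\int_D\Big[\sum_{j=1}^2\Big(\tfrac12\nabla v_j\cdot\nabla\bar w_j+V_jv_j\bar w_j\Big)+\tfrac{\delta}{2}(v_1\bar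 w_1-v_2\bar w_2)+\tfrac{\Omega}{2}(v_1\bar w_2+v_2\bar w_1)\Big]dx\\&+\Re\int_D i k_0\big(\bar w_1\partial_{x_1}v_1-\bar w_2\partial_{x_1}v_2\big)dx\\&+\frac1{\|u\|_{L^2}^2}\Re\int_D\Big[\sum_{j=1}^2\beta_{jj}|u_j|^2v_j\bar w_j+\beta_{12}\big(|u_2|^2v_1\bar w_1+|u_1|^2v_2\bar w_2\big)\Big]dx .\end{aligned}$$ Then $A(u)v\in\mathbf H^{-1}$ for all $u\in\mathbf H^1_0\setminus\{0\}$ and $v\in\mathbf H^1_0$, and the map $v\mapsto A(v)v$ from $\mathbf H^1_0\setminus\{0\}$ to $\mathbf H^{-1}$ is real Fréchet differentiable at every $u\in\mathbf H^1_0\setminus\{0\}$. Let $J(u):\mathbf H^1_0\to\mathbf H^{-1}$ denote its Fréchet derivative at $u$. For every $u\in\mathbf H^1_0\setminus\{0\}$ there is a constant $\sigma_0(u)\in\mathbb{R}$ such that $$\langle J(u)v,v\rangle\ \ge\ \tfrac18\,\|v\|_{H^1}^2-\sigma_0(u)\,\|v\|_{L^2}^2\qquad\text{for all }v\in\mathbf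 H^1_0 .$$ -/

import Mathlib

open MeasureTheory Set
open scoped ContDiff ComplexConjugate

noncomputable section

namespace SpinOrbit

/-- The Lebesgue measure on `D ⊆ ℝᵈ`. -/
abbrev volOn {d : ℕ} (D : Set (EuclideanSpace ℝ (Fin d))) :
    Measure (EuclideanSpace ℝ (Fin d)) :=
  volume.restrict D

/-- The space `L²(D, ℂ)`. -/
abbrev L2 {d : ℕ} (D : Set (EuclideanSpace ℝ (Fin d))) : Type :=
  Lp ℂ 2 (volOn D)

/-- Pairs `(f, g)` with `f ∈ L²(D, ℂ)` and `g ∈ L²(D, ℂ)ᵈ`, with the norm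
`(‖f‖² + ∑ i, ‖g i‖²)^(1/2)`. The space `H¹(D, ℂ)` embeds isometrically via `f ↦ (f, ∇f)`. -/
abbrev L2Jet {d : ℕ} (D : Set (EuclideanSpace ℝ (Fin d))) : Type :=
  WithLp 2 (L2 D × PiLp 2 (fun _ : Fin d => L2 D))

/-- The classical partial derivative `∂φ/∂xᵢ`. -/
def pderiv {d : ℕ} (i : Fin d) (φ : EuclideanSpace ℝ (Fin d) → ℂ)
    (x : EuclideanSpace ℝ (Fin d)) : ℂ :=
  fderiv ℝ φ x (EuclideanSpace.single i 1)

/-- `φ ∈ C_c^∞(D, ℂ)`. -/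
structure IsTestFunction {d : ℕ} (D : Set (EuclideanSpace ℝ (Fin d)))
    (φ : EuclideanSpace ℝ (Fin d) → ℂ) : Prop where
  smooth : ContDiff ℝ ∞ φ
  compact : HasCompactSupport φ
  support : tsupport φ ⊆ D

/-- The real vector space `{(φ, ∇φ) : φ ∈ C_c^∞(D, ℂ)}`. -/
def testJets {d : ℕ} (D : Set (EuclideanSpace ℝ (Fin d))) : Submodule ℝ (L2Jet D) where
  carrier := {p | ∃ φ, IsTestFunction D φ ∧ p.fst =ᵐ[volOn D] φ ∧
    ∀ i, p.snd i =ᵐ[volOn D] pderiv i φ}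
  zero_mem' := by
    refine ⟨0, ⟨contDiff_const, HasCompactSupport.zero, by simp [tsupport]⟩, ?_, fun i => ?_⟩
    · exact Lp.coeFn_zero ℂ 2 (volOn D)
    · have h : pderiv i (0 : EuclideanSpace ℝ (Fin d) → ℂ) = 0 := by
        funext x; simp [pderiv]
      rw [h]
      exact Lp.coeFn_zero ℂ 2 (volOn D)
  add_mem' := by
    rintro p q ⟨φ, hφ, hp, hp'⟩ ⟨ψ, hψ, hq, hq'⟩
    refine ⟨φ + ψ, ⟨hφ.smooth.add hψ.smooth, hφ.compact.add hψ.compact,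
      (tsupport_add φ ψ).trans (union_subset hφ.support hψ.support)⟩, ?_, fun i => ?_⟩
    · exact (Lp.coeFn_add p.fst q.fst).trans (hp.add hq)
    · have h : pderiv i (φ + ψ) = pderiv i φ + pderiv i ψ := by
        funext x
        simp only [pderiv, Pi.add_apply]
        rw [fderiv_add (hφ.smooth.differentiable (by simp) x)
          (hψ.smooth.differentiable (by simp) x)]
        rfl
      rw [h]
      exact (Lp.coeFn_add (p.snd i) (q.snd i)).trans ((hp' i).add (hq' i))
  smul_mem' := by
    rintro c p ⟨φ, hφ, hp, hp'⟩
    refine ⟨c • φ, ⟨hφ.smooth.const_smul c, hφ.compact.mono (Function.support_const_smul_subset c φ),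
      (closure_mono (Function.support_const_smul_subset c φ)).trans hφ.support⟩, ?_, fun i => ?_⟩
    · exact (Lp.coeFn_smul c p.fst).trans (hp.const_smul c)
    · have h : pderiv i (c • φ) = c • pderiv i φ := by
        funext x
        simp only [pderiv, Pi.smul_apply]
        rw [fderiv_const_smul (hφ.smooth.differentiable (by simp) x)]
        rfl
      rw [h]
      exact (Lp.coeFn_smul c (p.snd i)).trans ((hp' i).const_smul c)

/-- The Sobolev space `H¹₀(D, ℂ)`: the closure of `C_c^∞(D, ℂ)` in the `H¹`-norm. A function `f` is
recorded together with its weak gradient, as the pair `(f, ∇f)`. -/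
def H10 {d : ℕ} (D : Set (EuclideanSpace ℝ (Fin d))) : Submodule ℝ (L2Jet D) :=
  (testJets D).topologicalClosure

/-- Pairing with a continuous compactly supported function is continuous on `L²(D, ℂ)`. -/
theorem continuous_pairing {d : ℕ} (D : Set (EuclideanSpace ℝ (Fin d)))
    {ψ : EuclideanSpace ℝ (Fin d) → ℂ} (hc : Continuous ψ) (hs : HasCompactSupport ψ) :
    Continuous fun f : L2 D => ∫ x in D, f x * ψ x := by
  have hm : MemLp (fun x => conj (ψ x)) 2 (volOn D) :=
    (Complex.continuous_conj.comp hc).memLp_of_hasCompactSupport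
      (hs.comp_left (g := fun z : ℂ => conj z) (by simp))
  have h : (fun f : L2 D => ∫ x in D, f x * ψ x) = fun f => inner ℂ (hm.toLp _) f := by
    funext f
    rw [L2.inner_def]
    refine integral_congr_ae ?_
    filter_upwards [hm.coeFn_toLp] with x hx
    rw [hx]
    simp
  rw [h]
  fun_prop

/-- The second entry of an element of `H¹₀(D, ℂ)` is the weak gradient of the first one. -/
theorem H10_weak_gradient {d : ℕ} {D : Set (EuclideanSpace ℝ (Fin d))} {p : L2Jet D}
    (hp : p ∈ H10 D) (i : Fin d) {ψ : EuclideanSpace ℝ (Fin d) → ℂ} (hψ : IsTestFunction D ψ) :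
    ∫ x in D, p.fst x * pderiv i ψ x = - ∫ x in D, p.snd i x * ψ x := by
  have hc : Continuous (pderiv i ψ) :=
    (hψ.smooth.continuous_fderiv (by simp)).clm_apply continuous_const
  have hs : HasCompactSupport (pderiv i ψ) :=
    hψ.compact.fderiv_apply ℝ (EuclideanSpace.single i 1)
  have hcl : IsClosed {p : L2Jet D |
      ∫ x in D, p.fst x * pderiv i ψ x = - ∫ x in D, p.snd i x * ψ x} := by
    refine isClosed_eq ((continuous_pairing D hc hs).comp
      (g := fun f : L2 D => ∫ x in D, f x * pderiv i ψ x) (f := fun p : L2Jet D => p.fst)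
      (by fun_prop)) ?_
    exact ((continuous_pairing D hψ.smooth.continuous hψ.compact).comp
      (g := fun f : L2 D => ∫ x in D, f x * ψ x) (f := fun p : L2Jet D => p.snd i)
      (by fun_prop)).neg
  refine closure_minimal ?_ hcl hp
  rintro q ⟨φ, hφ, h0, h1⟩
  have hφc : Continuous (pderiv i φ) :=
    (hφ.smooth.continuous_fderiv (by simp)).clm_apply continuous_const
  have e1 : ∫ x in D, q.fst x * pderiv i ψ x = ∫ x, φ x * pderiv i ψ x := by
    rw [← setIntegral_eq_integral_of_forall_compl_eq_zero (s := D) (f := fun x => φ x * pderiv i ψ x)]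
    · refine integral_congr_ae ?_
      filter_upwards [h0] with x hx
      simp only [hx]
    · intro x hx
      rw [image_eq_zero_of_notMem_tsupport fun h => hx (hφ.support h), zero_mul]
  have e2 : ∫ x in D, q.snd i x * ψ x = ∫ x, pderiv i φ x * ψ x := by
    rw [← setIntegral_eq_integral_of_forall_compl_eq_zero (s := D) (f := fun x => pderiv i φ x * ψ x)]
    · refine integral_congr_ae ?_
      filter_upwards [h1 i] with x hx
      simp only [hx]
    · intro x hx
      rw [image_eq_zero_of_notMem_tsupport fun h => hx (hψ.support h), mul_zero]
  change ∫ x in D, q.fst x * pderiv i ψ x = - ∫ x in D, q.snd i x * ψ x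
  rw [e1, e2]
  exact integral_mul_fderiv_eq_neg_fderiv_mul_of_integrable
    ((hφc.mul hψ.smooth.continuous).integrable_of_hasCompactSupport hψ.compact.mul_left)
    ((hφ.smooth.continuous.mul hc).integrable_of_hasCompactSupport hs.mul_left)
    ((hφ.smooth.continuous.mul hψ.smooth.continuous).integrable_of_hasCompactSupport
      hψ.compact.mul_left)
    (fun x _ => hφ.smooth.differentiable (by simp) x)
    (fun x _ => hψ.smooth.differentiable (by simp) x)

/-- The space `𝐇¹₀(D) = H¹₀(D, ℂ²)` as a real normed space, with the (full) `H¹`-norm. -/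
abbrev H10Vec {d : ℕ} (D : Set (EuclideanSpace ℝ (Fin d))) : Type :=
  PiLp 2 (fun _ : Fin 2 => H10 D)

variable {d : ℕ} {D : Set (EuclideanSpace ℝ (Fin d))}

/-- The component `v_{j+1}` of `v = (v₁, v₂)`. -/
def H10Vec.comp (v : H10Vec D) (j : Fin 2) : L2 D :=
  (v j : L2Jet D).fst

/-- The weak partial derivative `∂v_{j+1}/∂x_{i+1}`. -/
def H10Vec.partial (v : H10Vec D) (j : Fin 2) (i : Fin d) : L2 D :=
  (v j : L2Jet D).snd i

/-- The norm of `v` in `𝐋²(D) = L²(D, ℂ²)`. -/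
def l2Norm (v : H10Vec D) : ℝ :=
  √(∑ j, ‖v.comp j‖ ^ 2)

/-- The norm on `𝐇¹₀(D)` is the usual `H¹`-norm. -/
theorem norm_sq_eq (v : H10Vec D) :
    ‖v‖ ^ 2 = l2Norm v ^ 2 + ∑ j, ∑ i, ‖v.partial j i‖ ^ 2 := by
  rw [PiLp.norm_sq_eq_of_L2, l2Norm, Real.sq_sqrt (by positivity), ← Finset.sum_add_distrib]
  refine Finset.sum_congr rfl fun j _ => ?_
  have h := WithLp.prod_norm_sq_eq_of_L2 (v j : L2Jet D)
  rw [PiLp.norm_sq_eq_of_L2] at h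
  exact h

/-- The data of a spin-orbit coupled pseudo-spin-1/2 Bose-Einstein condensate. -/
structure Data (d : ℕ) where
  /-- The trapping potentials `V₁`, `V₂`. -/
  V : Fin 2 → EuclideanSpace ℝ (Fin d) → ℝ
  /-- The detuning. -/
  δ : ℝ
  /-- The Rabi coupling. -/
  Ω : ℝ
  /-- The Raman recoil momentum. -/
  k₀ : ℝ
  β₁₁ : ℝ
  β₁₂ : ℝ
  β₂₂ : ℝ

/-- `V_j ∈ L^∞(D, ℝ_{≥0})`, the potentials dominate detuning, Rabi coupling and the
spin-orbit term, and the interactions are repulsive. -/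
structure Data.Admissible (P : Data d) (D : Set (EuclideanSpace ℝ (Fin d))) : Prop where
  bounded : ∀ j, MemLp (P.V j) ⊤ (volOn D)
  nonneg : ∀ j, ∀ᵐ x ∂volOn D, 0 ≤ P.V j x
  dominates : ∀ j, ∀ᵐ x ∂volOn D, 0 ≤ P.V j x - (|P.δ| + |P.Ω| + 2 * P.k₀ ^ 2) / 2
  β₁₁_nonneg : 0 ≤ P.β₁₁
  β₁₂_nonneg : 0 ≤ P.β₁₂
  β₂₂_nonneg : 0 ≤ P.β₂₂

/-- The form `⟨A(u)v, w⟩`. -/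
def formA [NeZero d] (P : Data d) (u v w : H10Vec D) : ℝ :=
  let u₁ := u.comp 0
  let u₂ := u.comp 1
  let v₁ := v.comp 0
  let v₂ := v.comp 1
  let w₁ := w.comp 0
  let w₂ := w.comp 1
  (∫ x in D,
      ((∑ j, ((1 / 2 : ℂ) * (∑ i, v.partial j i x * conj (w.partial j i x))
          + (P.V j x : ℂ) * v.comp j x * conj (w.comp j x)))
        + (P.δ / 2 : ℂ) * (v₁ x * conj (w₁ x) - v₂ x * conj (w₂ x))
        + (P.Ω / 2 : ℂ) * (v₁ x * conj (w₂ x) + v₂ x * conj (w₁ x)))).re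
  + (∫ x in D,
      Complex.I * (P.k₀ : ℂ)
        * (conj (w₁ x) * v.partial 0 0 x - conj (w₂ x) * v.partial 1 0 x)).re
  + (∫ x in D,
      (((P.β₁₁ / l2Norm u ^ 2 * ‖u₁ x‖ ^ 2 : ℝ) : ℂ) * v₁ x * conj (w₁ x)
        + ((P.β₂₂ / l2Norm u ^ 2 * ‖u₂ x‖ ^ 2 : ℝ) : ℂ) * v₂ x * conj (w₂ x)
        + ((P.β₁₂ / l2Norm u ^ 2 : ℝ) : ℂ)
          * (((‖u₂ x‖ ^ 2 : ℝ) : ℂ) * v₁ x * conj (w₁ x)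
            + ((‖u₁ x‖ ^ 2 : ℝ) : ℂ) * v₂ x * conj (w₂ x)))).re

open Classical in
/-- The functional `A(u)v ∈ 𝐇⁻¹(D)`, the dual of `𝐇¹₀(D)`: the continuous real-linear functional
`w ↦ ⟨A(u)v, w⟩`. -/
def opA [NeZero d] (P : Data d) (u v : H10Vec D) : StrongDual ℝ (H10Vec D) :=
  if h : ∃ ℓ : StrongDual ℝ (H10Vec D), ∀ w, ℓ w = formA P u v w then h.choose else 0

/-- The operator `J(u) : 𝐇¹₀(D) → 𝐇⁻¹(D)`: the real Fréchet derivative at `u` of `v ↦ A(v)v`. -/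
def opJ [NeZero d] (P : Data d) (u : H10Vec D) : H10Vec D →L[ℝ] StrongDual ℝ (H10Vec D) :=
  fderiv ℝ (fun v : H10Vec D => opA P v v) u

end SpinOrbit

end

noncomputable section

namespace SpinOrbit

open Filter Topology
open scoped ENNReal NNReal

/-! In dimensions two and three `H¹₀` embeds in `L⁴`, so `M(a, b) = Re(a conj b)` is a bounded
bilinear map from `H¹₀` into real `L²`. The interaction part of `⟨A(u)u, w⟩` is `‖u‖⁻² ∑ β_jk
(M(u_j, u_j), M(u_k, w_k))`, with both the norm and the pairing taken in `L²`. Hence `A(u)u` is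
built from bounded multilinear maps and a denominator that does not vanish for `u ≠ 0`, which gives
differentiability.

For the lower bound, the derivative in direction `v` is tested with `v`. In the linear part, half of
the kinetic energy absorbs the spin-orbit term by Young's inequality and the remaining terms are of
order zero, so `1/4 ‖v‖²` survives up to `L²` terms (`exists_linearForm_garding`). The contributions
`(|u_j|², |v_k|²)` are nonnegative. Two contributions have no definite sign.

The cross terms `2 β_jk (M(u_j, v_j), M(u_k, v_k))` are controlled by
`IsPairing.exists_norm_le_add`: up to a small `H¹` error `u_j` is a test function, hence bounded,
and multiplication by a bounded function costs only the `L²` norm of `v`. The derivative of `‖u‖⁻²`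
carries a factor `(u, v)` in `L²`, so it is at most a multiple of `‖v‖_{L²} ‖v‖_{H¹}`. In
`exists_garding` each of the two uses up `1/16 ‖v‖²`, and `1/8 ‖v‖²` remains. -/

instance : ENNReal.HolderTriple 4 4 2 where
  inv_add_inv_eq_inv := by
    rw [← ENNReal.toReal_eq_toReal_iff' (by simp) (by simp), ENNReal.toReal_add (by simp) (by simp)]
    norm_num [ENNReal.toReal_inv]

instance : Fact ((1 : ℝ≥0∞) ≤ 4) := ⟨by norm_num⟩

/-! ### Sobolev embedding into `L⁴`, and injectivity of `H¹₀ → L²`. -/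

section Sobolev

variable {d : ℕ} {D : Set (EuclideanSpace ℝ (Fin d))}

theorem norm_fderiv_le_sum_pderiv (φ : EuclideanSpace ℝ (Fin d) → ℂ)
    (x : EuclideanSpace ℝ (Fin d)) : ‖fderiv ℝ φ x‖ ≤ ∑ i, ‖pderiv i φ x‖ := by
  refine ContinuousLinearMap.opNorm_le_bound _ (by positivity) fun y => ?_
  have hy : y = ∑ i, y i • EuclideanSpace.single i (1 : ℝ) := by
    ext j
    simp [Finset.sum_apply, Pi.single_apply]
  calc ‖fderiv ℝ φ x y‖ = ‖∑ i, y i • pderiv i φ x‖ := by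
        conv_lhs => rw [hy]
        rw [map_sum]
        simp only [map_smul, pderiv]
    _ ≤ ∑ i, ‖pderiv i φ x‖ * ‖y‖ := by
        refine (norm_sum_le _ _).trans (Finset.sum_le_sum fun i _ => ?_)
        rw [norm_smul, mul_comm]
        gcongr
        exact PiLp.norm_apply_le y i
    _ = _ := by rw [Finset.sum_mul]

theorem IsTestFunction.continuous_pderiv {φ : EuclideanSpace ℝ (Fin d) → ℂ}
    (hφ : IsTestFunction D φ) (i : Fin d) : Continuous (pderiv i φ) :=
  (hφ.smooth.continuous_fderiv (by simp)).clm_apply continuous_const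

theorem IsTestFunction.support_fderiv_subset {φ : EuclideanSpace ℝ (Fin d) → ℂ}
    (hφ : IsTestFunction D φ) : Function.support (fderiv ℝ φ) ⊆ D :=
  (subset_tsupport _).trans ((tsupport_fderiv_subset ℝ).trans hφ.support)

theorem eLpNorm_volume_eq_volOn {F : Type*} [NormedAddCommGroup F]
    {φ : EuclideanSpace ℝ (Fin d) → F} (h : Function.support φ ⊆ D) (p : ℝ≥0∞) :
    eLpNorm φ p volume = eLpNorm φ p (volOn D) :=
  (eLpNorm_restrict_eq_of_support_subset h).symm

theorem IsTestFunction.eLpNorm_fderiv_restrict {φ : EuclideanSpace ℝ (Fin d) → ℂ}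
    (hφ : IsTestFunction D φ) (p : ℝ≥0∞) :
    eLpNorm (fderiv ℝ φ) p volume = eLpNorm (fderiv ℝ φ) p (volOn D) :=
  eLpNorm_volume_eq_volOn hφ.support_fderiv_subset p

/-- The Sobolev inequality `‖φ‖_{L⁴} ≤ C ‖∇φ‖_{L²}` for test functions in dimensions two and
three. -/
theorem exists_eLpNorm_four_le_fderiv (hd : d = 2 ∨ d = 3) (hDb : Bornology.IsBounded D) :
    ∃ C : ℝ≥0, ∀ φ : EuclideanSpace ℝ (Fin d) → ℂ, IsTestFunction D φ →
      eLpNorm φ 4 (volOn D) ≤ C * eLpNorm (fderiv ℝ φ) 2 (volOn D) := by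
  rcases hd with rfl | rfl
  · have hfin : volume D ≠ ⊤ := hDb.measure_lt_top.ne
    -- In the plane the exponent 2 is critical. The exponent `4/3 < 2` has Sobolev conjugate exactly
    -- 4, and Hölder's inequality on the bounded set `D` then passes from `L^{4/3}` to `L²` at the
    -- price of `|D|^{1/4}`.
    refine ⟨eLpNormLESNormFDerivOfLeConst ℂ volume D (4 / 3 : ℝ≥0) 4 *
      (volume D ^ (1 / 4 : ℝ)).toNNReal, fun φ hφ => ?_⟩
    have h := eLpNorm_le_eLpNorm_fderiv_of_le volume (u := φ) (s := D) (p := 4 / 3) (q := 4)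
      (hφ.smooth.of_le (by simp)) ((subset_tsupport _).trans hφ.support)
      (by rw [one_le_div (by norm_num)]; norm_num)
      (by
        rw [← NNReal.coe_lt_coe]
        simp
        norm_num)
      (by simp; norm_num) hDb
    have h2 := eLpNorm_le_eLpNorm_mul_rpow_measure_univ (μ := volOn D) (f := fderiv ℝ φ)
      (p := ((4 / 3 : ℝ≥0) : ℝ≥0∞)) (q := 2)
      (by
        have : ((4 / 3 : ℝ≥0)) ≤ 2 := by rw [div_le_iff₀ (by norm_num)]; norm_num
        exact_mod_cast this)
      (hφ.smooth.continuous_fderiv (by simp)).aestronglyMeasurable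
    have hexp : (1 / ((4 / 3 : ℝ≥0) : ℝ≥0∞).toReal - 1 / (2 : ℝ≥0∞).toReal) = 1 / 4 := by
      rw [ENNReal.coe_toReal]
      norm_num
    rw [hexp, Measure.restrict_apply_univ] at h2
    rw [hφ.eLpNorm_fderiv_restrict] at h
    have hcoe : (((volume D ^ (1 / 4 : ℝ)).toNNReal : ℝ≥0) : ℝ≥0∞) = volume D ^ (1 / 4 : ℝ) :=
      ENNReal.coe_toNNReal (ENNReal.rpow_ne_top_of_nonneg (by norm_num) hfin)
    calc eLpNorm φ 4 (volOn D) ≤ eLpNorm φ (4 : ℝ≥0) volume := by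
          simpa using eLpNorm_mono_measure φ Measure.restrict_le_self
      _ ≤ _ := h
      _ ≤ _ := mul_le_mul_right h2 _
      _ = _ := by rw [ENNReal.coe_mul, hcoe]; ring
  -- In dimension three the conjugate exponent of 2 is 6, and 4 lies below it because `D` is
  -- bounded: `1/2 - 1/3 ≤ 1/4`.
  · refine ⟨eLpNormLESNormFDerivOfLeConst ℂ volume D 2 4, fun φ hφ => ?_⟩
    have h := eLpNorm_le_eLpNorm_fderiv_of_le volume (u := φ) (s := D) (p := 2) (q := 4)
      (hφ.smooth.of_le (by simp)) ((subset_tsupport _).trans hφ.support)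
      (by norm_num)
      (by
        rw [← NNReal.coe_lt_coe]
        simp
        norm_num)
      (by simp; norm_num) hDb
    rw [hφ.eLpNorm_fderiv_restrict] at h
    calc eLpNorm φ 4 (volOn D) ≤ eLpNorm φ (4 : ℝ≥0) volume := by
          simpa using eLpNorm_mono_measure φ Measure.restrict_le_self
      _ ≤ _ := h
      _ = _ := by simp

theorem norm_snd_apply_le (p : L2Jet D) (i : Fin d) : ‖p.snd i‖ ≤ ‖p‖ :=
  (PiLp.norm_apply_le p.snd i).trans (WithLp.norm_snd_le _ p)

theorem exists_eLpNorm_four_le_of_mem_testJets (hd : d = 2 ∨ d = 3)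
    (hDb : Bornology.IsBounded D) :
    ∃ C : ℝ≥0, ∀ p ∈ testJets D, eLpNorm p.fst 4 (volOn D) ≤ C * ‖p‖ₑ := by
  obtain ⟨C, hC⟩ := exists_eLpNorm_four_le_fderiv hd hDb
  refine ⟨C * d, ?_⟩
  rintro p ⟨φ, hφ, h0, h1⟩
  rw [eLpNorm_congr_ae h0]
  refine (hC φ hφ).trans ?_
  rw [ENNReal.coe_mul, mul_assoc]
  refine mul_le_mul_right ?_ _
  calc eLpNorm (fderiv ℝ φ) 2 (volOn D)
      ≤ eLpNorm (∑ i, fun x => ‖pderiv i φ x‖) 2 (volOn D) := by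
        refine eLpNorm_mono_real fun x => ?_
        rw [Finset.sum_apply]
        exact norm_fderiv_le_sum_pderiv φ x
    _ ≤ ∑ i, eLpNorm (fun x => ‖pderiv i φ x‖) 2 (volOn D) :=
        eLpNorm_sum_le (fun i _ => (hφ.continuous_pderiv i).norm.aestronglyMeasurable)
          (by norm_num)
    _ ≤ ∑ i : Fin d, ‖p‖ₑ := by
        refine Finset.sum_le_sum fun i _ => ?_
        rw [eLpNorm_norm, ← eLpNorm_congr_ae (h1 i), ← Lp.enorm_def]
        rw [← ofReal_norm, ← ofReal_norm]
        exact ENNReal.ofReal_le_ofReal (norm_snd_apply_le p i)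
    _ = _ := by simp

/-- The bound passes to the closure by Fatou's lemma: approximating test functions converge in `L²`,
hence almost everywhere along a subsequence, and the `L⁴` norm is lower semicontinuous under such
convergence. -/
theorem exists_eLpNorm_four_le (hd : d = 2 ∨ d = 3) (hDb : Bornology.IsBounded D) :
    ∃ C : ℝ≥0, ∀ p ∈ H10 D, eLpNorm p.fst 4 (volOn D) ≤ C * ‖p‖ₑ := by
  obtain ⟨C, hC⟩ := exists_eLpNorm_four_le_of_mem_testJets hd hDb
  refine ⟨C, fun p hp => ?_⟩
  obtain ⟨q, hq, hlim⟩ := mem_closure_iff_seq_limit.1 hp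
  have hfst : Tendsto (fun n => (q n).fst) atTop (𝓝 p.fst) :=
    ((by fun_prop : Continuous fun p : L2Jet D => p.fst).tendsto p).comp hlim
  have hm : TendstoInMeasure (volOn D) (fun n => ((q n).fst : _ → ℂ)) atTop p.fst :=
    tendstoInMeasure_of_tendsto_Lp hfst
  obtain ⟨ns, hns, hae⟩ := hm.exists_seq_tendsto_ae
  have hnorm : Tendsto (fun n => C * ‖q (ns n)‖ₑ) atTop (𝓝 (C * ‖p‖ₑ)) :=
    ENNReal.Tendsto.const_mul ((continuous_enorm.tendsto p).comp (hlim.comp hns.tendsto_atTop))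
      (Or.inr ENNReal.coe_ne_top)
  calc eLpNorm p.fst 4 (volOn D)
      ≤ liminf (fun n => eLpNorm (q (ns n)).fst 4 (volOn D)) atTop :=
        Lp.eLpNorm_lim_le_liminf_eLpNorm (fun n => Lp.aestronglyMeasurable _) _ hae
    _ ≤ liminf (fun n => C * ‖q (ns n)‖ₑ) atTop :=
        liminf_le_liminf (Eventually.of_forall fun n => hC _ (hq _))
    _ = _ := hnorm.liminf_eq

/-- An element of `H¹₀(D)` whose function part vanishes is zero. -/
theorem H10_eq_zero_of_fst_eq_zero (hD : IsOpen D) {p : L2Jet D} (hp : p ∈ H10 D)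
    (h0 : p.fst = 0) : p = 0 := by
  have hsnd : ∀ i, p.snd i = 0 := by
    intro i
    rw [Lp.eq_zero_iff_ae_eq_zero]
    have hloc : LocallyIntegrable (p.snd i : _ → ℂ) (volOn D) :=
      (Lp.memLp (p.snd i)).locallyIntegrable (by norm_num)
    have := hD.ae_eq_zero_of_integral_contDiff_smul_eq_zero (μ := volume)
      (f := (p.snd i : _ → ℂ)) (locallyIntegrableOn_of_locallyIntegrable_restrict hloc) ?_
    · exact (ae_restrict_iff' hD.measurableSet).2 this
    -- Fundamental lemma of the calculus of variations: real test functions suffice, and for each of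
    -- them the weak gradient identity moves the derivative onto `g`, where it meets the zero
    -- function.
    · intro g hg hgc hgs
      have htest : IsTestFunction D (fun x => (g x : ℂ)) :=
        { smooth := Complex.ofRealCLM.contDiff.comp hg
          compact := hgc.comp_left (g := fun t : ℝ => (t : ℂ)) (by simp)
          support := by
            refine (closure_mono fun x hx => ?_).trans hgs
            simpa using hx }
      have h := H10_weak_gradient hp i htest
      have hl : ∫ x in D, p.fst x * pderiv i (fun x => (g x : ℂ)) x = 0 := by
        rw [h0]
        refine integral_eq_zero_of_ae ?_
        filter_upwards [Lp.coeFn_zero ℂ 2 (volOn D)] with x hx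
        change (0 : L2 D) x * _ = 0
        rw [hx, Pi.zero_apply, zero_mul]
      rw [hl, eq_comm, neg_eq_zero] at h
      rw [← setIntegral_eq_integral_of_forall_compl_eq_zero (s := D), ← h]
      · refine integral_congr_ae (Eventually.of_forall fun x => ?_)
        simp [mul_comm]
      · intro x hx
        rw [image_eq_zero_of_notMem_tsupport fun h => hx (hgs h), zero_smul]
  have : p.snd = 0 := by ext1 i; exact hsnd i
  exact WithLp.ofLp_injective 2 (Prod.ext h0 this)

end Sobolev

/-! ### The pointwise product as a bounded bilinear map from `H¹₀` into `L²`. -/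

section Pairing

variable {d : ℕ} {D : Set (EuclideanSpace ℝ (Fin d))}

theorem memLp_four_of_H10 (hd : d = 2 ∨ d = 3) (hDb : Bornology.IsBounded D) (a : H10 D) :
    MemLp (a : L2Jet D).fst 4 (volOn D) := by
  obtain ⟨C, hC⟩ := exists_eLpNorm_four_le hd hDb
  exact ⟨Lp.aestronglyMeasurable _, (hC a a.2).trans_lt
    (ENNReal.mul_lt_top ENNReal.coe_lt_top enorm_lt_top)⟩

/-- The Sobolev embedding of `H¹₀(D, ℂ)` into `L⁴(D, ℂ)`. -/
theorem exists_embedding_four (hd : d = 2 ∨ d = 3) (hDb : Bornology.IsBounded D) :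
    ∃ ι : H10 D →L[ℝ] Lp ℂ 4 (volOn D), ∀ a, ι a =ᵐ[volOn D] (a : L2Jet D).fst := by
  obtain ⟨C, hC⟩ := exists_eLpNorm_four_le hd hDb
  have hm := memLp_four_of_H10 hd hDb
  let f : H10 D →ₗ[ℝ] Lp ℂ 4 (volOn D) :=
    { toFun := fun a => (hm a).toLp _
      map_add' := fun a b => by
        rw [← MemLp.toLp_add]
        exact MemLp.toLp_congr _ _ (Lp.coeFn_add _ _)
      map_smul' := fun c a => by
        rw [RingHom.id_apply, ← MemLp.toLp_const_smul]
        exact MemLp.toLp_congr _ _ (Lp.coeFn_smul _ _) }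
  refine ⟨f.mkContinuous C fun a => ?_, fun a => (hm a).coeFn_toLp⟩
  change ‖(hm a).toLp _‖ ≤ _
  rw [Lp.norm_toLp]
  have := ENNReal.toReal_mono (ENNReal.mul_ne_top ENNReal.coe_ne_top enorm_ne_top) (hC a a.2)
  simpa [ENNReal.toReal_mul] using this

/-- `M a b` is the function `x ↦ Re (a(x) conj(b(x)))`. -/
def IsPairing (M : H10 D →L[ℝ] H10 D →L[ℝ] Lp ℝ 2 (volOn D)) : Prop :=
  ∀ a b, M a b =ᵐ[volOn D] fun x => inner ℝ ((a : L2Jet D).fst x) ((b : L2Jet D).fst x)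

/-- Hölder's inequality for `L⁴ × L⁴ → L²`, precomposed with the Sobolev embedding in both
arguments. -/
theorem exists_isPairing (hd : d = 2 ∨ d = 3) (hDb : Bornology.IsBounded D) :
    ∃ M : H10 D →L[ℝ] H10 D →L[ℝ] Lp ℝ 2 (volOn D), IsPairing M := by
  obtain ⟨ι, hι⟩ := exists_embedding_four hd hDb
  refine ⟨(ContinuousLinearMap.holderL (volOn D) 4 4 2
    (innerSL ℝ : ℂ →L[ℝ] ℂ →L[ℝ] ℝ)).bilinearComp ι ι, fun a b => ?_⟩
  rw [ContinuousLinearMap.bilinearComp_apply, ContinuousLinearMap.holderL_apply_apply]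
  filter_upwards [ContinuousLinearMap.coeFn_holder (r := 2)
    (innerSL ℝ : ℂ →L[ℝ] ℂ →L[ℝ] ℝ) (ι a) (ι b), hι a, hι b] with x h1 h2 h3
  rw [h1, h2, h3, innerSL_apply_apply]

variable {M : H10 D →L[ℝ] H10 D →L[ℝ] Lp ℝ 2 (volOn D)}

theorem IsPairing.comm (hM : IsPairing M) (a b : H10 D) : M a b = M b a := by
  refine Lp.ext ?_
  filter_upwards [hM a b, hM b a] with x h1 h2
  rw [h1, h2, real_inner_comm]

theorem IsPairing.inner_nonneg (hM : IsPairing M) (a b : H10 D) :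
    0 ≤ inner ℝ (M a a) (M b b) := by
  rw [L2.inner_def]
  refine integral_nonneg_of_ae ?_
  filter_upwards [hM a a, hM b b] with x h1 h2
  rw [h1, h2]
  exact mul_nonneg real_inner_self_nonneg real_inner_self_nonneg

theorem IsPairing.norm_le_of_bounded (hM : IsPairing M) {a : H10 D} {C : ℝ}
    (ha : ∀ᵐ x ∂volOn D, ‖(a : L2Jet D).fst x‖ ≤ C) (b : H10 D) :
    ‖M a b‖ ≤ C * ‖(b : L2Jet D).fst‖ := by
  refine Lp.norm_le_mul_norm_of_ae_le_mul ?_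
  filter_upwards [hM a b, ha] with x h1 h2
  rw [h1]
  exact (norm_inner_le_norm _ _).trans (by gcongr)

theorem exists_bound_bilin {H G : Type*} [NormedAddCommGroup H] [NormedSpace ℝ H]
    [NormedAddCommGroup G] [NormedSpace ℝ G] (B : H →L[ℝ] H →L[ℝ] G) :
    ∃ K, 0 < K ∧ ∀ a b, ‖B a b‖ ≤ K * ‖a‖ * ‖b‖ := by
  refine ⟨‖B‖ + 1, by positivity, fun a b => (B.le_opNorm₂ a b).trans ?_⟩
  gcongr
  linarith

/-- Multiplication by a fixed element of `H¹₀` is, up to an arbitrarily small `H¹`-contribution,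
controlled by the `L²`-norm. -/
theorem IsPairing.exists_norm_le_add (hM : IsPairing M) (a : H10 D) {ε : ℝ} (hε : 0 < ε) :
    ∃ C, 0 ≤ C ∧ ∀ b : H10 D, ‖M a b‖ ≤ ε * ‖b‖ + C * ‖(b : L2Jet D).fst‖ := by
  obtain ⟨K, hK, hMK⟩ := exists_bound_bilin M
  -- Split `a = (a - q) + q` with `q` a test function. The first part is small in `H¹` and is
  -- handled by continuity of `M`; the second is bounded, and its supremum bound serves as `C`.
  obtain ⟨q, hq, hqa⟩ := Metric.mem_closure_iff.1
    (show (a : L2Jet D) ∈ closure (testJets D : Set (L2Jet D)) from a.2) (ε / K)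
    (by positivity)
  obtain ⟨φ, hφ, h0, -⟩ := id hq
  obtain ⟨C, hC⟩ := hφ.compact.exists_bound_of_continuous hφ.smooth.continuous
  let q' : H10 D := ⟨q, subset_closure hq⟩
  have hdist : ‖a - q'‖ ≤ ε / K := by
    rw [dist_eq_norm] at hqa
    exact hqa.le
  refine ⟨C, (norm_nonneg _).trans (hC 0), fun b => ?_⟩
  calc ‖M a b‖ = ‖M (a - q') b + M q' b‖ := by simp
    _ ≤ ‖M (a - q') b‖ + ‖M q' b‖ := norm_add_le _ _
    _ ≤ ε * ‖b‖ + C * ‖(b : L2Jet D).fst‖ := by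
        refine add_le_add ?_ (hM.norm_le_of_bounded ?_ b)
        · refine (hMK _ _).trans ?_
          gcongr
          calc K * ‖a - q'‖ ≤ K * (ε / K) := by gcongr
            _ = ε := by field_simp
        · filter_upwards [h0] with x hx
          change ‖q.fst x‖ ≤ C
          rw [hx]
          exact hC x

end Pairing

/-! ### Differentiation and Gårding inequality for the abstract nonlinear map. -/

section Abstract

variable {H K ι : Type*} [NormedAddCommGroup H] [NormedSpace ℝ H] [NormedAddCommGroup K]
  [InnerProductSpace ℝ K] [Fintype ι]

/-- The functional `w ↦ ∑ⱼₖ βⱼₖ ⟪Bⱼ(u, u), Bₖ(v, w)⟫`. -/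
def quarticForm (β : ι → ι → ℝ) (B : ι → H →L[ℝ] H →L[ℝ] K) (u v : H) : H →L[ℝ] ℝ :=
  ∑ j, ∑ k, β j k • (innerSL ℝ (B j u u)).comp (B k v)

theorem quarticForm_apply (β : ι → ι → ℝ) (B : ι → H →L[ℝ] H →L[ℝ] K) (u v w : H) :
    quarticForm β B u v w = ∑ j, ∑ k, β j k * inner ℝ (B j u u) (B k v w) := by
  simp [quarticForm]

theorem hasDerivAt_bilin_line {G : Type*} [NormedAddCommGroup G] [NormedSpace ℝ G]
    (B : H →L[ℝ] H →L[ℝ] G) (u v : H) :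
    HasDerivAt (fun t : ℝ => B (u + t • v) (u + t • v)) (B u v + B v u) 0 := by
  have hl : HasDerivAt (fun t : ℝ => u + t • v) v 0 := by
    simpa using ((hasDerivAt_id (0 : ℝ)).smul_const v).const_add u
  simpa using B.hasFDerivAt_of_bilinear hl.hasFDerivAt hl.hasFDerivAt |>.hasDerivAt

theorem differentiableAt_nonlinear (L S : H →L[ℝ] H →L[ℝ] ℝ) (β : ι → ι → ℝ)
    (B : ι → H →L[ℝ] H →L[ℝ] K) {u : H} (hu : S u u ≠ 0) :
    DifferentiableAt ℝ (fun x => L x + (S x x)⁻¹ • quarticForm β B x x) u := by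
  unfold quarticForm
  have h1 : DifferentiableAt ℝ (fun x => (S x x)⁻¹) u :=
    DifferentiableAt.inv (by fun_prop) hu
  refine L.differentiableAt.add (h1.smul ?_)
  refine DifferentiableAt.fun_sum fun j _ => DifferentiableAt.fun_sum fun k _ => ?_
  refine DifferentiableAt.fun_const_smul ?_ (β j k)
  refine DifferentiableAt.clm_comp ?_ (B k).differentiableAt
  exact (innerSL ℝ).differentiableAt.comp u (by fun_prop)

/-- Once differentiability is known, it suffices to restrict to the line `u + t v` and test with
`v`. This leaves the derivative of a scalar function of `t`, computed by the product rule and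
identified by uniqueness. -/
theorem fderiv_nonlinear_apply_self (L S : H →L[ℝ] H →L[ℝ] ℝ) (β : ι → ι → ℝ)
    (B : ι → H →L[ℝ] H →L[ℝ] K) {u : H} (hu : S u u ≠ 0) (v : H) :
    fderiv ℝ (fun x => L x + (S x x)⁻¹ • quarticForm β B x x) u v v =
      L v v + (-(S u v + S v u) / S u u ^ 2 * quarticForm β B u u v +
        (S u u)⁻¹ * ∑ j, ∑ k, β j k *
          (inner ℝ (B j u u) (B k v v) + inner ℝ (B j u v + B j v u) (B k u v))) := by
  have hd := (differentiableAt_nonlinear L S β B hu).hasFDerivAt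
  have hl : HasDerivAt (fun t : ℝ => u + t • v) v 0 := by
    simpa using ((hasDerivAt_id (0 : ℝ)).smul_const v).const_add u
  have h1 : HasDerivAt (fun t : ℝ => (L (u + t • v) + (S (u + t • v) (u + t • v))⁻¹ •
      quarticForm β B (u + t • v) (u + t • v)) v)
      (fderiv ℝ (fun x => L x + (S x x)⁻¹ • quarticForm β B x x) u v v) 0 := by
    have := HasFDerivAt.comp_hasDerivAt_of_eq (0 : ℝ) hd hl (by simp)
    simpa using this.clm_apply (hasDerivAt_const (0 : ℝ) v)
  refine h1.unique ?_
  simp only [add_apply, FunLike.coe_smul, Pi.smul_apply, smul_eq_mul, quarticForm_apply]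
  have hS := (hasDerivAt_bilin_line S u v).inv (by simpa using hu)
  have hq : HasDerivAt (fun t : ℝ => ∑ j, ∑ k, β j k *
      inner ℝ (B j (u + t • v) (u + t • v)) (B k (u + t • v) v))
      (∑ j, ∑ k, β j k *
        (inner ℝ (B j u u) (B k v v) + inner ℝ (B j u v + B j v u) (B k u v))) 0 := by
    refine HasDerivAt.fun_sum fun j _ => HasDerivAt.fun_sum fun k _ => HasDerivAt.const_mul _ ?_
    have hb : HasDerivAt (fun t : ℝ => B k (u + t • v) v) (B k v v) 0 := by
      have := ((B k).flip v).hasFDerivAt.comp_hasDerivAt (0 : ℝ) hl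
      simp only [ContinuousLinearMap.flip_apply] at this
      exact this
    simpa using (hasDerivAt_bilin_line (B j) u v).inner ℝ hb
  have hL : HasDerivAt (fun t : ℝ => L (u + t • v) v) (L v v) 0 := by
    have := (L.flip v).hasFDerivAt.comp_hasDerivAt (0 : ℝ) hl
    simp only [ContinuousLinearMap.flip_apply] at this
    exact this
  have := hL.fun_add (hS.fun_mul hq)
  simpa only [Pi.inv_apply, zero_smul, add_zero] using this

/-- A Gårding inequality for the derivative of `x ↦ L x + S(x, x)⁻¹ ∑ⱼₖ βⱼₖ ⟪Bⱼ(x, x), Bₖ(x, ·)⟫`.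
Here `m` plays the role of a norm weaker than the one of `H`. -/
theorem exists_garding (L S : H →L[ℝ] H →L[ℝ] ℝ) (β : ι → ι → ℝ)
    (B : ι → H →L[ℝ] H →L[ℝ] K) (m : H → ℝ) (hm : ∀ v, 0 ≤ m v) {u : H} (hu : 0 < S u u)
    (hβ : ∀ j k, 0 ≤ β j k) (hBsymm : ∀ j v w, B j v w = B j w v)
    (hBnonneg : ∀ j k v w, 0 ≤ inner ℝ (B j v v) (B k w w))
    (hBsmall : ∀ j, ∀ ε > 0, ∃ C, 0 ≤ C ∧ ∀ v, ‖B j u v‖ ≤ ε * ‖v‖ + C * m v)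
    (hS : ∀ v w, |S v w| ≤ m v * m w) {c : ℝ} (hc : 0 < c)
    (hL : ∃ C, ∀ v, 2 * c * ‖v‖ ^ 2 - C * m v ^ 2 ≤ L v v) :
    ∃ σ, ∀ v, c * ‖v‖ ^ 2 - σ * m v ^ 2 ≤
      fderiv ℝ (fun x => L x + (S x x)⁻¹ • quarticForm β B x x) u v v := by
  obtain ⟨C₀, hC₀⟩ := hL
  set b := ∑ j, ∑ k, β j k with hb
  have hb0 : 0 ≤ b := Finset.sum_nonneg fun j _ => Finset.sum_nonneg fun k _ => hβ j k
  set s := S u u with hs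
  -- Chosen so that `4 b ε² / s ≤ c / 2`, where `b` is the total interaction strength; `b + 1` keeps
  -- the denominator positive when `b = 0`.
  set ε := √(c * s / (8 * (b + 1))) with hε
  have hε0 : 0 < ε := by positivity
  have hεsq : ε ^ 2 = c * s / (8 * (b + 1)) := Real.sq_sqrt (by positivity)
  choose C hC0 hC using fun j => hBsmall j ε hε0
  set C₁ := ∑ j, C j with hC₁
  have hBu : ∀ j v, ‖B j u v‖ ≤ ε * ‖v‖ + C₁ * m v := fun j v => by
    refine (hC j v).trans ?_
    have := Finset.single_le_sum (fun i _ => hC0 i) (Finset.mem_univ j)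
    have := mul_le_mul_of_nonneg_right this (hm v)
    linarith
  have hC₁0 : 0 ≤ C₁ := Finset.sum_nonneg fun j _ => hC0 j
  set R := ‖quarticForm β B u u‖
  set Q := 2 * m u * R / s ^ 2 with hQ
  -- The three summands are the `m`-costs of the linear part, of the quartic part and of the
  -- normalisation. The last two also cost `c / 2 * ‖v‖ ^ 2` each, which reduces `2 * c` to `c`.
  refine ⟨C₀ + 4 * b * C₁ ^ 2 / s + Q ^ 2 / (2 * c), fun v => ?_⟩
  rw [fderiv_nonlinear_apply_self L S β B hu.ne' v, ← hs]
  have hquad : -(b * (4 * ε ^ 2 * ‖v‖ ^ 2 + 4 * C₁ ^ 2 * m v ^ 2)) ≤ ∑ j, ∑ k, β j k *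
      (inner ℝ (B j u u) (B k v v) + inner ℝ (B j u v + B j v u) (B k u v)) := by
    rw [hb, Finset.sum_mul, ← Finset.sum_neg_distrib]
    refine Finset.sum_le_sum fun j _ => ?_
    rw [Finset.sum_mul, ← Finset.sum_neg_distrib]
    refine Finset.sum_le_sum fun k _ => ?_
    rw [← mul_neg]
    refine mul_le_mul_of_nonneg_left ?_ (hβ j k)
    -- The term with `B j u u` and `B k v v` is dropped by sign. The symmetric cross term is at
    -- least `-2 (ε‖v‖ + C₁ m v)²`, which is split by `(x + y)² ≤ 2x² + 2y²`.
    have h1 := hBnonneg j k u v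
    rw [hBsymm j v u, ← two_smul ℝ, real_inner_smul_left]
    have h2 := (abs_le.1 (abs_real_inner_le_norm (B j u v) (B k u v))).1
    have h3 : ‖B j u v‖ * ‖B k u v‖ ≤ (ε * ‖v‖ + C₁ * m v) * (ε * ‖v‖ + C₁ * m v) :=
      mul_le_mul (hBu j v) (hBu k v) (norm_nonneg _) ((norm_nonneg _).trans (hBu j v))
    nlinarith [sq_nonneg (ε * ‖v‖ - C₁ * m v)]
  have hquad' : -(c / 2 * ‖v‖ ^ 2 + 4 * b * C₁ ^ 2 / s * m v ^ 2) ≤ s⁻¹ * ∑ j, ∑ k, β j k *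
      (inner ℝ (B j u u) (B k v v) + inner ℝ (B j u v + B j v u) (B k u v)) := by
    refine le_trans ?_ (mul_le_mul_of_nonneg_left hquad (inv_nonneg.2 hu.le))
    have h1 : s⁻¹ * (b * (4 * ε ^ 2)) ≤ c / 2 := by
      rw [hεsq]
      have : s⁻¹ * (b * (4 * (c * s / (8 * (b + 1))))) = c / 2 * (b / (b + 1)) := by
        field_simp
        ring
      rw [this]
      have : b / (b + 1) ≤ 1 := (div_le_one (by positivity)).2 (by linarith)
      nlinarith
    have h2 := mul_le_mul_of_nonneg_right h1 (sq_nonneg ‖v‖)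
    have h3 : s⁻¹ * -(b * (4 * ε ^ 2 * ‖v‖ ^ 2 + 4 * C₁ ^ 2 * m v ^ 2)) =
        -(s⁻¹ * (b * (4 * ε ^ 2)) * ‖v‖ ^ 2 + 4 * b * C₁ ^ 2 / s * m v ^ 2) := by
      field_simp
    rw [h3]
    linarith
  -- Differentiating `(S x x)⁻¹` produces a factor of size `m u * m v`, so this term is only linear
  -- in `‖v‖` and Young's inequality absorbs it.
  have hdens : -(c / 2 * ‖v‖ ^ 2 + Q ^ 2 / (2 * c) * m v ^ 2) ≤
      -(S u v + S v u) / s ^ 2 * quarticForm β B u u v := by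
    have h1 : |S u v + S v u| ≤ 2 * m u * m v := by
      refine (abs_add_le _ _).trans ?_
      linarith [hS u v, hS v u]
    have h2 : |-(S u v + S v u) / s ^ 2 * quarticForm β B u u v| ≤ Q * m v * ‖v‖ := by
      rw [abs_mul, abs_div, abs_neg, abs_of_nonneg (sq_nonneg s)]
      have h3 : |quarticForm β B u u v| ≤ R * ‖v‖ :=
        (quarticForm β B u u).le_opNorm v
      calc |S u v + S v u| / s ^ 2 * |quarticForm β B u u v|
          ≤ (2 * m u * m v) / s ^ 2 * (R * ‖v‖) :=
            mul_le_mul (by gcongr) h3 (abs_nonneg _)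
              (div_nonneg ((abs_nonneg _).trans h1) (sq_nonneg s))
        _ = _ := by rw [hQ]; ring
    have h3 := (abs_le.1 h2).1
    have h4 : Q * m v * ‖v‖ ≤ c / 2 * ‖v‖ ^ 2 + Q ^ 2 / (2 * c) * m v ^ 2 := by
      have h5 : c / 2 * ‖v‖ ^ 2 + Q ^ 2 / (2 * c) * m v ^ 2 - Q * m v * ‖v‖ =
          (c * ‖v‖ - Q * m v) ^ 2 / (2 * c) := by
        field_simp
        ring
      have : 0 ≤ (c * ‖v‖ - Q * m v) ^ 2 / (2 * c) := by positivity
      linarith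
    linarith
  have := hC₀ v
  linarith

end Abstract

/-! ### Real parts of integrals, with integrability carried along so that they add up. -/

section ReIntegral

variable {α : Type*} [MeasurableSpace α] {μ : Measure α}

/-- `F` is integrable and the real part of its integral is `r`. -/
def HasReIntegral (μ : Measure α) (F : α → ℂ) (r : ℝ) : Prop :=
  Integrable F μ ∧ (∫ x, F x ∂μ).re = r

namespace HasReIntegral

variable {F G : α → ℂ} {r s : ℝ}

theorem add (hF : HasReIntegral μ F r) (hG : HasReIntegral μ G s) :
    HasReIntegral μ (fun x => F x + G x) (r + s) :=
  ⟨hF.1.add hG.1, by rw [integral_add hF.1 hG.1, Complex.add_re, hF.2, hG.2]⟩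

theorem sub (hF : HasReIntegral μ F r) (hG : HasReIntegral μ G s) :
    HasReIntegral μ (fun x => F x - G x) (r - s) :=
  ⟨hF.1.sub hG.1, by rw [integral_sub hF.1 hG.1, Complex.sub_re, hF.2, hG.2]⟩

theorem const_mul (c : ℝ) (hF : HasReIntegral μ F r) :
    HasReIntegral μ (fun x => (c : ℂ) * F x) (c * r) :=
  ⟨hF.1.const_mul _, by rw [integral_const_mul, Complex.re_ofReal_mul, hF.2]⟩

theorem sum {ι : Type*} {s : Finset ι} {F : ι → α → ℂ} {r : ι → ℝ}
    (hF : ∀ i ∈ s, HasReIntegral μ (F i) (r i)) :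
    HasReIntegral μ (fun x => ∑ i ∈ s, F i x) (∑ i ∈ s, r i) :=
  ⟨integrable_finsetSum _ fun i hi => (hF i hi).1, by
    rw [integral_finsetSum _ fun i hi => (hF i hi).1, Complex.re_sum]
    exact Finset.sum_congr rfl fun i hi => (hF i hi).2⟩

theorem congr (hF : HasReIntegral μ F r) (h : F =ᵐ[μ] G) : HasReIntegral μ G r :=
  ⟨hF.1.congr h, by rw [← integral_congr_ae h, hF.2]⟩

theorem mul_conj (f g : Lp ℂ 2 μ) :
    HasReIntegral μ (fun x => f x * conj (g x)) (inner ℝ f g) := by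
  have hi : Integrable (fun x => f x * conj (g x)) μ := by
    simpa [RCLike.inner_apply] using L2.integrable_inner (𝕜 := ℂ) g f
  refine ⟨hi, ?_⟩
  have := integral_re hi
  simp only [RCLike.re_eq_complex_re] at this
  rw [← this, L2.inner_def]
  refine integral_congr_ae (Eventually.of_forall fun x => ?_)
  simp [Complex.inner, mul_comm]

end HasReIntegral

theorem eq_add_of_hasReIntegral {F G K : α → ℂ} {a b c : ℝ} (hF : HasReIntegral μ F a)
    (hG : HasReIntegral μ G b) (hK : HasReIntegral μ K c) :
    (∫ x, F x ∂μ).re + (∫ x, G x ∂μ).re + (∫ x, K x ∂μ).re = a + b + c := by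
  rw [hF.2, hG.2, hK.2]

end ReIntegral

/-! ### The `u`-independent part of the form and its Gårding inequality. -/

section AbstractForms

variable {d : ℕ} [NeZero d] {H K : Type*} [NormedAddCommGroup H] [NormedSpace ℝ H]
  [NormedAddCommGroup K] [InnerProductSpace ℝ K]

/-- The bilinear form `(v, w) ↦ ⟪A v, B w⟫`. -/
def pullInner (A B : H →L[ℝ] K) : H →L[ℝ] H →L[ℝ] ℝ :=
  (innerSL ℝ).bilinearComp A B

theorem pullInner_apply (A B : H →L[ℝ] K) (v w : H) :
    pullInner A B v w = inner ℝ (A v) (B w) := rfl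

/-- The bilinear form `(v, w) ↦ ∑ⱼ ⟪cⱼ v, cⱼ w⟫`. -/
def sumInner (c : Fin 2 → H →L[ℝ] K) : H →L[ℝ] H →L[ℝ] ℝ :=
  ∑ j, pullInner (c j) (c j)

theorem sumInner_apply (c : Fin 2 → H →L[ℝ] K) (v w : H) :
    sumInner c v w = ∑ j, inner ℝ (c j v) (c j w) := by
  simp only [sumInner, sum_apply, pullInner_apply]

/-- The part of `⟨A(u)v, w⟩` that does not depend on `u`, in abstract form: the operators `c j`,
`p j i`, `W j` and `I` stand for the components, their partial derivatives, the multiplication by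
the potentials and the multiplication by the imaginary unit. -/
def linearForm (P : Data d) (c : Fin 2 → H →L[ℝ] K) (p : Fin 2 → Fin d → H →L[ℝ] K)
    (W : Fin 2 → K →L[ℝ] K) (I : K →L[ℝ] K) : H →L[ℝ] H →L[ℝ] ℝ :=
  ((∑ j, ((1 / 2 : ℝ) • (∑ i, pullInner (p j i) (p j i)) + pullInner ((W j).comp (c j)) (c j)))
    + (P.δ / 2) • (pullInner (c 0) (c 0) - pullInner (c 1) (c 1))
    + (P.Ω / 2) • (pullInner (c 0) (c 1) + pullInner (c 1) (c 0)))
  + P.k₀ • (pullInner (I.comp (p 0 0)) (c 0) - pullInner (I.comp (p 1 0)) (c 1))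

theorem linearForm_apply (P : Data d) (c : Fin 2 → H →L[ℝ] K) (p : Fin 2 → Fin d → H →L[ℝ] K)
    (W : Fin 2 → K →L[ℝ] K) (I : K →L[ℝ] K) (v w : H) :
    linearForm P c p W I v w =
      ((∑ j, ((1 / 2 : ℝ) * (∑ i, inner ℝ (p j i v) (p j i w)) + inner ℝ (W j (c j v)) (c j w)))
        + (P.δ / 2) * (inner ℝ (c 0 v) (c 0 w) - inner ℝ (c 1 v) (c 1 w))
        + (P.Ω / 2) * (inner ℝ (c 0 v) (c 1 w) + inner ℝ (c 1 v) (c 0 w)))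
      + P.k₀ * (inner ℝ (I (p 0 0 v)) (c 0 w) - inner ℝ (I (p 1 0 v)) (c 1 w)) := by
  simp only [linearForm, add_apply, sub_apply, sum_apply, FunLike.coe_smul, Pi.smul_apply,
    smul_eq_mul, pullInner_apply, ContinuousLinearMap.comp_apply]

/-- The Gårding inequality for the linear part. -/
theorem exists_linearForm_garding (P : Data d) (c : Fin 2 → H →L[ℝ] K)
    (p : Fin 2 → Fin d → H →L[ℝ] K) (W : Fin 2 → K →L[ℝ] K) (I : K →L[ℝ] K)
    (hI : ∀ f, ‖I f‖ = ‖f‖) :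
    ∃ C, ∀ v, 1 / 4 * (∑ j, ‖c j v‖ ^ 2 + ∑ j, ∑ i, ‖p j i v‖ ^ 2) - C * (∑ j, ‖c j v‖ ^ 2) ≤
      linearForm P c p W I v v := by
  -- The leading `1 / 4` cancels the `L²` part of the `H¹` norm on the left; the other summands pay
  -- for the potentials, the detuning, the Rabi coupling and the spin-orbit term.
  refine ⟨1 / 4 + (‖W 0‖ + ‖W 1‖) + |P.δ| / 2 + |P.Ω| + P.k₀ ^ 2, fun v => ?_⟩
  rw [linearForm_apply]
  simp only [Fin.sum_univ_two, real_inner_self_eq_norm_sq]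
  have hW : ∀ j, -(‖W j‖ * ‖c j v‖ ^ 2) ≤ inner ℝ (W j (c j v)) (c j v) := fun j => by
    have h1 := (abs_le.1 (abs_real_inner_le_norm (W j (c j v)) (c j v))).1
    have h2 := mul_le_mul_of_nonneg_right ((W j).le_opNorm (c j v)) (norm_nonneg (c j v))
    linarith
  -- Young's inequality weighted so that exactly half of the kinetic coefficient `1 / 2` is used.
  have hk : ∀ j, |P.k₀ * inner ℝ (I (p j 0 v)) (c j v)| ≤
      1 / 4 * (∑ i, ‖p j i v‖ ^ 2) + P.k₀ ^ 2 * ‖c j v‖ ^ 2 := fun j => by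
    have h1 := abs_real_inner_le_norm (I (p j 0 v)) (c j v)
    rw [hI] at h1
    have h2 : ‖p j 0 v‖ ^ 2 ≤ ∑ i, ‖p j i v‖ ^ 2 :=
      Finset.single_le_sum (f := fun i => ‖p j i v‖ ^ 2) (fun _ _ => sq_nonneg _)
        (Finset.mem_univ 0)
    rw [abs_mul]
    have h3 := mul_le_mul_of_nonneg_left h1 (abs_nonneg P.k₀)
    have h4 := sq_nonneg (1 / 2 * ‖p j 0 v‖ - |P.k₀| * ‖c j v‖)
    have h5 := sq_abs P.k₀
    rw [← h5]
    linarith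
  have hδ : ∀ j, |P.δ / 2 * ‖c j v‖ ^ 2| = |P.δ| / 2 * ‖c j v‖ ^ 2 := fun j => by
    rw [abs_mul, abs_div, abs_of_nonneg (sq_nonneg ‖c j v‖), abs_two]
  have hΩ : |P.Ω / 2 * (2 * inner ℝ (c 0 v) (c 1 v))| ≤
      |P.Ω| * (‖c 0 v‖ ^ 2 + ‖c 1 v‖ ^ 2) := by
    have h1 := abs_real_inner_le_norm (c 0 v) (c 1 v)
    have h2 : P.Ω / 2 * (2 * inner ℝ (c 0 v) (c 1 v)) =
      P.Ω * inner ℝ (c 0 v) (c 1 v) := by ring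
    rw [h2, abs_mul]
    refine mul_le_mul_of_nonneg_left (h1.trans ?_) (abs_nonneg _)
    nlinarith [sq_nonneg (‖c 0 v‖ - ‖c 1 v‖), sq_nonneg ‖c 0 v‖, sq_nonneg ‖c 1 v‖]
  have hW0 := hW 0
  have hW1 := hW 1
  -- The spin-orbit and detuning terms enter with opposite signs in the two components, so a lower
  -- bound is needed for the first and an upper bound for the second.
  have hk0 := (abs_le.1 (hk 0)).1
  have hk1 := (abs_le.1 (hk 1)).2
  have hδ0 := neg_abs_le (P.δ / 2 * ‖c 0 v‖ ^ 2)
  have hδ1 := le_abs_self (P.δ / 2 * ‖c 1 v‖ ^ 2)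
  rw [hδ] at hδ0 hδ1
  have hΩ' := (abs_le.1 hΩ).1
  rw [real_inner_comm (c 0 v) (c 1 v)]
  -- The constant multiplies both components by `‖W 0‖ + ‖W 1‖`; the two surplus products are
  -- nonnegative.
  have hx : 0 ≤ ‖W 0‖ * ‖c 1 v‖ ^ 2 := by positivity
  have hy : 0 ≤ ‖W 1‖ * ‖c 0 v‖ ^ 2 := by positivity
  linarith

end AbstractForms

/-! ### Multiplication operators on `L²`. -/

section Forms

variable {d : ℕ} {D : Set (EuclideanSpace ℝ (Fin d))}

/-- Multiplication by a bounded real function on `L²(D, ℂ)`. -/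
theorem exists_mulL {V : EuclideanSpace ℝ (Fin d) → ℝ} (hV : MemLp V ⊤ (volOn D)) :
    ∃ W : L2 D →L[ℝ] L2 D, ∀ f, W f =ᵐ[volOn D] fun x => (V x : ℂ) * f x := by
  refine ⟨(ContinuousLinearMap.lsmul ℝ ℝ : ℝ →L[ℝ] ℂ →L[ℝ] ℂ).holderL (volOn D) ⊤ 2 2
    (hV.toLp V), fun f => ?_⟩
  rw [ContinuousLinearMap.holderL_apply_apply]
  filter_upwards [ContinuousLinearMap.coeFn_holder (r := 2)
    (ContinuousLinearMap.lsmul ℝ ℝ : ℝ →L[ℝ] ℂ →L[ℝ] ℂ) (hV.toLp V) f, hV.coeFn_toLp]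
    with x h1 h2
  rw [h1, h2]
  simp

/-- Multiplication by the imaginary unit on `L²(D, ℂ)`. -/
def mulI : L2 D →L[ℝ] L2 D :=
  (Complex.I • ContinuousLinearMap.id ℂ (L2 D)).restrictScalars ℝ

theorem mulI_ae (f : L2 D) : mulI f =ᵐ[volOn D] fun x => Complex.I * f x :=
  Lp.coeFn_smul Complex.I f

theorem norm_mulI (f : L2 D) : ‖mulI f‖ = ‖f‖ := by
  change ‖Complex.I • f‖ = ‖f‖
  rw [norm_smul, Complex.norm_I, one_mul]

end Forms

/-! ### The form `A(u)` written with inner products, and its Gårding inequality. -/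

section AbstractModel

variable {d : ℕ} [NeZero d] {E K K₂ : Type*} [NormedAddCommGroup E] [NormedSpace ℝ E]
  [NormedAddCommGroup K] [InnerProductSpace ℝ K] [NormedAddCommGroup K₂] [InnerProductSpace ℝ K₂]

/-- The matrix of the interaction strengths. -/
def Data.β (P : Data d) : Fin 2 → Fin 2 → ℝ := ![![P.β₁₁, P.β₁₂], ![P.β₁₂, P.β₂₂]]

/-- The form `⟨A(u)v, w⟩` expressed by inner products: `f` stands for the inclusion of `H¹₀` into
`L²`, `g i` for the partial derivatives, `W j` for the multiplication by `V j`, `I` for the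
multiplication by the imaginary unit and `M` for the pointwise inner product. -/
def modelForm (P : Data d) (f : E →L[ℝ] K) (g : Fin d → E →L[ℝ] K) (W : Fin 2 → K →L[ℝ] K)
    (I : K →L[ℝ] K) (M : E →L[ℝ] E →L[ℝ] K₂) (u v w : PiLp 2 (fun _ : Fin 2 => E)) : ℝ :=
  ((∑ j, ((1 / 2 : ℝ) * (∑ i, inner ℝ (g i (v j)) (g i (w j)))
      + inner ℝ (W j (f (v j))) (f (w j))))
    + (P.δ / 2) * (inner ℝ (f (v 0)) (f (w 0)) - inner ℝ (f (v 1)) (f (w 1)))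
    + (P.Ω / 2) * (inner ℝ (f (v 0)) (f (w 1)) + inner ℝ (f (v 1)) (f (w 0))))
  + P.k₀ * (inner ℝ (I (g 0 (v 0))) (f (w 0)) - inner ℝ (I (g 0 (v 1))) (f (w 1)))
  + (∑ j, ‖f (u j)‖ ^ 2)⁻¹ *
    ∑ j, ∑ k, P.β j k * inner ℝ (M (u j) (u j)) (M (v k) (w k))

/-- The `j`-th component of a pair, followed by `f`. -/
def onComp (f : E →L[ℝ] K) (j : Fin 2) : PiLp 2 (fun _ : Fin 2 => E) →L[ℝ] K :=
  f.comp (PiLp.proj 2 (fun _ : Fin 2 => E) j)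

/-- The `j`-th components of two pairs, followed by the bilinear map `M`. -/
def onComp₂ (M : E →L[ℝ] E →L[ℝ] K₂) (j : Fin 2) :
    PiLp 2 (fun _ : Fin 2 => E) →L[ℝ] PiLp 2 (fun _ : Fin 2 => E) →L[ℝ] K₂ :=
  M.bilinearComp (PiLp.proj 2 (fun _ : Fin 2 => E) j) (PiLp.proj 2 (fun _ : Fin 2 => E) j)

theorem modelForm_eq (P : Data d) (f : E →L[ℝ] K) (g : Fin d → E →L[ℝ] K)
    (W : Fin 2 → K →L[ℝ] K) (I : K →L[ℝ] K) (M : E →L[ℝ] E →L[ℝ] K₂)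
    (u v w : PiLp 2 (fun _ : Fin 2 => E)) :
    modelForm P f g W I M u v w =
      (linearForm P (onComp f) (fun j i => onComp (g i) j) W I v +
        (sumInner (onComp f) u u)⁻¹ • quarticForm P.β (onComp₂ M) u v) w := by
  rw [add_apply, linearForm_apply, FunLike.coe_smul, Pi.smul_apply, quarticForm_apply,
    sumInner_apply, smul_eq_mul]
  simp only [real_inner_self_eq_norm_sq]
  rfl

/-- If `A(z)z` is represented by `modelForm`, then `z ↦ A(z)z` is differentiable away from zero and
its derivative satisfies a Gårding inequality. -/
theorem exists_modelForm_garding (P : Data d) (f : E →L[ℝ] K) (g : Fin d → E →L[ℝ] K)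
    (W : Fin 2 → K →L[ℝ] K) (I : K →L[ℝ] K) (M : E →L[ℝ] E →L[ℝ] K₂)
    (hβ : ∀ j k, 0 ≤ P.β j k) (hnorm : ∀ e, ‖e‖ ^ 2 = ‖f e‖ ^ 2 + ∑ i, ‖g i e‖ ^ 2)
    (hf : ∀ e, f e = 0 → e = 0) (hI : ∀ h, ‖I h‖ = ‖h‖) (hM : ∀ a b, M a b = M b a)
    (hM0 : ∀ a b, 0 ≤ inner ℝ (M a a) (M b b))
    (hMsmall : ∀ a, ∀ ε > 0, ∃ C, 0 ≤ C ∧ ∀ b, ‖M a b‖ ≤ ε * ‖b‖ + C * ‖f b‖)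
    (A : PiLp 2 (fun _ : Fin 2 => E) → StrongDual ℝ (PiLp 2 (fun _ : Fin 2 => E)))
    (hA : ∀ z, z ≠ 0 → ∀ w, A z w = modelForm P f g W I M z z w)
    {u : PiLp 2 (fun _ : Fin 2 => E)} (hu : u ≠ 0) :
    DifferentiableAt ℝ A u ∧ ∃ σ : ℝ, ∀ v,
      fderiv ℝ A u v v ≥ 1 / 8 * ‖v‖ ^ 2 - σ * ∑ j, ‖f (v j)‖ ^ 2 := by
  set L := linearForm P (onComp f) (fun j i => onComp (g i) j) W I
  set S := sumInner (onComp f)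
  set m : PiLp 2 (fun _ : Fin 2 => E) → ℝ := fun v => √(∑ j, ‖f (v j)‖ ^ 2) with hm
  have hmsq : ∀ v, m v ^ 2 = ∑ j, ‖f (v j)‖ ^ 2 := fun v => Real.sq_sqrt (by positivity)
  have hfm : ∀ v j, ‖f (v j)‖ ≤ m v := fun v j => Real.le_sqrt_of_sq_le
    (Finset.single_le_sum (f := fun j => ‖f (v j)‖ ^ 2) (fun _ _ => sq_nonneg _)
      (Finset.mem_univ j))
  have hSu : 0 < S u u := by
    have hne : ∃ j, u j ≠ 0 := by
      by_contra! h
      exact hu (PiLp.ext h)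
    obtain ⟨j, hj⟩ := hne
    rw [sumInner_apply]
    refine Finset.sum_pos' (fun j _ => real_inner_self_nonneg) ⟨j, Finset.mem_univ j, ?_⟩
    exact real_inner_self_pos.2 fun h => hj (hf _ h)
  -- The representation of `A` is assumed only away from zero, an open set containing `u`, which is
  -- enough for derivatives at `u`.
  have hAe : A =ᶠ[𝓝 u] fun z => L z + (S z z)⁻¹ • quarticForm P.β (onComp₂ M) z z := by
    filter_upwards [isOpen_ne.mem_nhds hu] with z hz
    ext w
    rw [hA z hz w, modelForm_eq]
  refine ⟨(differentiableAt_nonlinear L S P.β (onComp₂ M) hSu.ne').congr_of_eventuallyEq hAe, ?_⟩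
  rw [hAe.fderiv_eq]
  obtain ⟨σ, hσ⟩ := exists_garding L S P.β (onComp₂ M) m (fun v => Real.sqrt_nonneg _) hSu hβ
    (fun j v w => hM _ _) (fun j k v w => hM0 _ _)
    (fun j ε hε => by
      obtain ⟨C, hC, h⟩ := hMsmall (u j) ε hε
      refine ⟨C, hC, fun v => (h (v j)).trans ?_⟩
      have h1 : ‖v j‖ ≤ ‖v‖ := PiLp.norm_apply_le v j
      have h2 := hfm v j
      gcongr)
    (fun v w => by
      rw [sumInner_apply]
      exact (Finset.abs_sum_le_sum_abs _ _).trans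
        ((Finset.sum_le_sum fun j _ => abs_real_inner_le_norm _ _).trans
          (Real.sum_mul_le_sqrt_mul_sqrt _ _ _)))
    -- Here `2 * c = 1 / 4` is the coercivity constant of the linear part.
    (c := 1 / 8) (by norm_num)
    (by
      obtain ⟨C, hC⟩ := exists_linearForm_garding P (onComp f) (fun j i => onComp (g i) j) W I hI
      refine ⟨C, fun v => le_trans (le_of_eq ?_) (hC v)⟩
      rw [hmsq, PiLp.norm_sq_eq_of_L2]
      simp only [hnorm, Finset.sum_add_distrib]
      change _ = 1 / 4 * (∑ j, ‖f (v j)‖ ^ 2 + ∑ j, ∑ i, ‖g i (v j)‖ ^ 2) -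
        C * ∑ j, ‖f (v j)‖ ^ 2
      norm_num)
  refine ⟨σ, fun v => ?_⟩
  rw [← hmsq]
  exact hσ v

end AbstractModel

/-! ### Identification of the integral form with the model, and conclusion. -/

section Concrete

variable {d : ℕ} {D : Set (EuclideanSpace ℝ (Fin d))}

/-- The inclusion of `H¹₀(D, ℂ)` into `L²(D, ℂ)`. -/
def inclL (D : Set (EuclideanSpace ℝ (Fin d))) : H10 D →L[ℝ] L2 D :=
  (WithLp.fstL 2 ℝ (L2 D) (PiLp 2 (fun _ : Fin d => L2 D))).comp (H10 D).subtypeL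

/-- The weak partial derivative as a map from `H¹₀(D, ℂ)` to `L²(D, ℂ)`. -/
def gradL (D : Set (EuclideanSpace ℝ (Fin d))) (i : Fin d) : H10 D →L[ℝ] L2 D :=
  (PiLp.proj 2 (fun _ : Fin d => L2 D) i).comp
    ((WithLp.sndL 2 ℝ (L2 D) (PiLp 2 (fun _ : Fin d => L2 D))).comp (H10 D).subtypeL)

theorem H10_norm_sq_eq (a : H10 D) : ‖a‖ ^ 2 = ‖inclL D a‖ ^ 2 + ∑ i, ‖gradL D i a‖ ^ 2 := by
  have h := WithLp.prod_norm_sq_eq_of_L2 (a : L2Jet D)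
  rw [PiLp.norm_sq_eq_of_L2] at h
  exact h

theorem l2Norm_sq (v : H10Vec D) : l2Norm v ^ 2 = ∑ j, ‖v.comp j‖ ^ 2 :=
  Real.sq_sqrt (by positivity)

theorem integrable_quartic {α : Type*} [MeasurableSpace α] {a b c : α → ℂ}
    {μ : Measure α} (ha : MemLp a 4 μ) (hb : MemLp b 4 μ)
    (hc : MemLp c 4 μ) : Integrable (fun x => ((‖a x‖ ^ 2 : ℝ) : ℂ) * (b x * conj (c x))) μ := by
  have h1 : MemLp (fun x => ((‖a x‖ ^ 2 : ℝ) : ℂ)) 2 μ := by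
    have h : MemLp (fun x => ‖a x‖ * ‖a x‖) 2 μ := MemLp.mul (p := 4) (q := 4) ha.norm ha.norm
    simp only [← sq] at h
    exact h.ofReal
  have h2 : MemLp (fun x => b x * conj (c x)) 2 μ := MemLp.mul (p := 4) (q := 4) hc.star hb
  exact h1.integrable_mul h2

theorem hasReIntegral_quartic {α : Type*} [MeasurableSpace α] {a b c : α → ℂ} {μ : Measure α}
    (ha : MemLp a 4 μ) (hb : MemLp b 4 μ) (hc : MemLp c 4 μ) {F G : Lp ℝ 2 μ}
    (hF : F =ᵐ[μ] fun x => inner ℝ (a x) (a x)) (hG : G =ᵐ[μ] fun x => inner ℝ (b x) (c x)) :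
    HasReIntegral μ (fun x => ((‖a x‖ ^ 2 : ℝ) : ℂ) * (b x * conj (c x))) (inner ℝ F G) := by
  have hi := integrable_quartic ha hb hc
  refine ⟨hi, ?_⟩
  have h := integral_re hi
  simp only [RCLike.re_eq_complex_re] at h
  rw [← h, L2.inner_def]
  refine integral_congr_ae ?_
  filter_upwards [hF, hG] with x h1 h2
  rw [h1, h2, Complex.re_ofReal_mul, real_inner_self_eq_norm_sq]
  simp [Complex.inner, mul_comm]

variable {M : H10 D →L[ℝ] H10 D →L[ℝ] Lp ℝ 2 (volOn D)}

theorem IsPairing.hasReIntegral (hM : IsPairing M) (hd : d = 2 ∨ d = 3)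
    (hDb : Bornology.IsBounded D) (a b c : H10 D) :
    HasReIntegral (volOn D) (fun x => ((‖(a : L2Jet D).fst x‖ ^ 2 : ℝ) : ℂ) *
      ((b : L2Jet D).fst x * conj ((c : L2Jet D).fst x))) (inner ℝ (M a a) (M b c)) :=
  hasReIntegral_quartic (memLp_four_of_H10 hd hDb a) (memLp_four_of_H10 hd hDb b)
    (memLp_four_of_H10 hd hDb c) (hM a a) (hM b c)

theorem exists_mulL_family {P : Data d} (hP : P.Admissible D) :
    ∃ W : Fin 2 → L2 D →L[ℝ] L2 D,
      ∀ j f, W j f =ᵐ[volOn D] fun x => (P.V j x : ℂ) * f x :=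
  ⟨fun j => (exists_mulL (hP.bounded j)).choose, fun j => (exists_mulL (hP.bounded j)).choose_spec⟩

variable [NeZero d]

theorem formA_eq_modelForm (hM : IsPairing M) (hd : d = 2 ∨ d = 3) (hDb : Bornology.IsBounded D)
    (P : Data d) {W : Fin 2 → L2 D →L[ℝ] L2 D}
    (hW : ∀ j f, W j f =ᵐ[volOn D] fun x => (P.V j x : ℂ) * f x) (u v w : H10Vec D) :
    formA P u v w = modelForm P (inclL D) (gradL D) W mulI M u v w := by
  have hpot : ∀ j, HasReIntegral (volOn D)
      (fun x => (P.V j x : ℂ) * v.comp j x * conj (w.comp j x))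
      (inner ℝ (W j (v.comp j)) (w.comp j)) := fun j => by
    refine (HasReIntegral.mul_conj (W j (v.comp j)) (w.comp j)).congr ?_
    filter_upwards [hW j (v.comp j)] with x hx
    rw [hx]
  have h1 := ((HasReIntegral.sum (s := Finset.univ) fun j _ =>
    ((HasReIntegral.sum (s := Finset.univ) fun i _ =>
      HasReIntegral.mul_conj (v.partial j i) (w.partial j i)).const_mul (1 / 2)).add (hpot j)).add
    (((HasReIntegral.mul_conj (v.comp 0) (w.comp 0)).sub
      (HasReIntegral.mul_conj (v.comp 1) (w.comp 1))).const_mul (P.δ / 2))).add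
    (((HasReIntegral.mul_conj (v.comp 0) (w.comp 1)).add
      (HasReIntegral.mul_conj (v.comp 1) (w.comp 0))).const_mul (P.Ω / 2))
  have h2 := ((HasReIntegral.mul_conj (mulI (v.partial 0 0)) (w.comp 0)).sub
    (HasReIntegral.mul_conj (mulI (v.partial 1 0)) (w.comp 1))).const_mul P.k₀
  have h3 := (((hM.hasReIntegral hd hDb (u 0) (v 0) (w 0)).const_mul (P.β₁₁ / l2Norm u ^ 2)).add
    ((hM.hasReIntegral hd hDb (u 1) (v 1) (w 1)).const_mul (P.β₂₂ / l2Norm u ^ 2))).add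
    (((hM.hasReIntegral hd hDb (u 1) (v 0) (w 0)).add
      (hM.hasReIntegral hd hDb (u 0) (v 1) (w 1))).const_mul (P.β₁₂ / l2Norm u ^ 2))
  refine Eq.trans (eq_add_of_hasReIntegral (h1.congr ?_) (h2.congr ?_) (h3.congr ?_)) ?_
  · refine Eventually.of_forall fun x => ?_
    push_cast
    rfl
  · filter_upwards [mulI_ae (v.partial 0 0), mulI_ae (v.partial 1 0)] with x hx hy
    rw [hx, hy]
    ring
  · refine Eventually.of_forall fun x => ?_
    simp only [H10Vec.comp]
    push_cast
    ring
  · have hβ : P.β₁₁ / l2Norm u ^ 2 * inner ℝ (M (u 0) (u 0)) (M (v 0) (w 0))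
        + P.β₂₂ / l2Norm u ^ 2 * inner ℝ (M (u 1) (u 1)) (M (v 1) (w 1))
        + P.β₁₂ / l2Norm u ^ 2 * (inner ℝ (M (u 1) (u 1)) (M (v 0) (w 0))
          + inner ℝ (M (u 0) (u 0)) (M (v 1) (w 1))) =
        (∑ j, ‖inclL D (u j)‖ ^ 2)⁻¹ *
          ∑ j, ∑ k, P.β j k * inner ℝ (M (u j) (u j)) (M (v k) (w k)) := by
      have hn : ∑ j, ‖inclL D (u j)‖ ^ 2 = l2Norm u ^ 2 := (l2Norm_sq u).symm
      rw [hn]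
      simp only [Fin.sum_univ_two, Data.β, Matrix.cons_val_zero, Matrix.cons_val_one]
      ring
    rw [hβ]
    rfl

/-- The model form is a continuous functional of `w`, so the choice in `opA` has a witness. No
condition `z ≠ 0` is needed: at `z = 0` both expressions divide by zero with value zero. -/
theorem opA_apply (hd : d = 2 ∨ d = 3) (hDb : Bornology.IsBounded D) {P : Data d}
    (hP : P.Admissible D) (z v w : H10Vec D) : opA P z v w = formA P z v w := by
  obtain ⟨M, hM⟩ := exists_isPairing hd hDb
  obtain ⟨W, hW⟩ := exists_mulL_family hP
  have h : ∃ ℓ : StrongDual ℝ (H10Vec D), ∀ w, ℓ w = formA P z v w :=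
    ⟨_, fun w => ((formA_eq_modelForm hM hd hDb P hW z v w).trans
      (modelForm_eq P (inclL D) (gradL D) W mulI M z v w)).symm⟩
  rw [opA, dif_pos h]
  exact h.choose_spec w

theorem opA_garding (hd : d = 2 ∨ d = 3) (hD : IsOpen D) (hDb : Bornology.IsBounded D)
    {P : Data d} (hP : P.Admissible D) {u : H10Vec D} (hu : u ≠ 0) :
    DifferentiableAt ℝ (fun v : H10Vec D => opA P v v) u ∧
      ∃ σ : ℝ, ∀ v : H10Vec D, opJ P u v v ≥ 1 / 8 * ‖v‖ ^ 2 - σ * l2Norm v ^ 2 := by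
  obtain ⟨M, hM⟩ := exists_isPairing hd hDb
  obtain ⟨W, hW⟩ := exists_mulL_family hP
  have hβ : ∀ j k, 0 ≤ P.β j k := by
    intro j k
    fin_cases j <;> fin_cases k
    exacts [hP.β₁₁_nonneg, hP.β₁₂_nonneg, hP.β₁₂_nonneg, hP.β₂₂_nonneg]
  obtain ⟨h1, σ, h2⟩ := exists_modelForm_garding P (inclL D) (gradL D) W mulI M hβ H10_norm_sq_eq
    -- Elements of `H10 D` are pairs of a function and a gradient, so injectivity of the inclusion
    -- into `L²` is what turns `u ≠ 0` into a nonzero `L²` norm.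
    (fun e he => Subtype.ext (H10_eq_zero_of_fst_eq_zero hD e.2 he)) norm_mulI hM.comm
    hM.inner_nonneg (fun a ε hε => hM.exists_norm_le_add a hε) (fun v : H10Vec D => opA P v v)
    (fun z _ w => (opA_apply hd hDb hP z z w).trans
      (formA_eq_modelForm hM hd hDb P hW z z w)) hu
  refine ⟨h1, σ, fun v => ?_⟩
  rw [l2Norm_sq]
  exact h2 v

end Concrete

end SpinOrbit

end

theorem lemma5p2 {d : ℕ} [NeZero d] (hd : d = 2 ∨ d = 3)
    (D : Set (EuclideanSpace ℝ (Fin d))) (hD : IsOpen D) (hDb : Bornology.IsBounded D)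
    (P : SpinOrbit.Data d) (hP : P.Admissible D)
    (u : SpinOrbit.H10Vec D) (hu : u ≠ 0) :
    -- `A(z)v` is a well-defined element of the dual space, for `z ≠ 0`
    (∀ z v w : SpinOrbit.H10Vec D, z ≠ 0 →
      SpinOrbit.opA P z v w = SpinOrbit.formA P z v w) ∧
    -- the Fréchet derivative that defines `J(u)` exists
    DifferentiableAt ℝ (fun v : SpinOrbit.H10Vec D => SpinOrbit.opA P v v) u ∧
    -- the Gårding inequality
    ∃ σ₀ : ℝ, ∀ v : SpinOrbit.H10Vec D,
      SpinOrbit.opJ P u v v ≥ 1 / 8 * ‖v‖ ^ 2 - σ₀ * SpinOrbit.l2Norm v ^ 2 := by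
  obtain ⟨hdiff, hgarding⟩ := SpinOrbit.opA_garding hd hD hDb hP hu
  exact ⟨fun z v w _ => SpinOrbit.opA_apply hd hDb hP z v w, hdiff, hgarding⟩
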